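/- Let $\Omega=\{0,1\}^{\mathbb N}$, and let $\mathcal M(\Omega)$ be the space of Borel probability measures on $\Omega$ with the weak topology. For a finite binary word $x$ let $x\Omega$ be the set of sequences beginning with $x$; these are the basic sets of $\Omega$. A basic set $\beta\subseteq\mathcal M(\Omega)$ is the set of all $P$ satisfying finitely many conditions $u<P(y\Omega)<v$ with $y$ a binary word and $u,v$ rational; the basic sets of $\Omega\times\mathcal M(\Omega)$ are the products $x\Omega\times\beta$. A function $t$ on $\Omega$ or on $\Omega\times\mathcal M(\Omega)$ with values in $[0,\infty]$ is lower semicomputable if, uniformly in rational $r$, the set $\{t>r\}$ is the union of a recursively enumerable family of basic sets. A uniform test is a lower semicomputable $t(\omega,P)$ with $\int t(\omega,P)\,dP(\omega)\le 1$ for all $P\in\mathcal M(\Omega)$; it is universal if it dominates every uniform test up to a constant factor. A sequence $\omega$ is uniformly random with respect to $P$ if $\mathbf t(\omega,P)<\infty$ for a universal uniform test $\mathbf t$ (the choice of which does not matter). A blind (oracle-free) test for $P$ is a lower semicomputable $t:\Omega\to[0,\infty]$ with $\int t\,dP\le 1$; a sequence $\omega$ is blindly random with respect to $P$ if $t(\omega)<\infty$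 for every blind test $t$ for $P$. A class $\mathcal C\subseteq\mathcal M(\Omega)$ is effectively compact if it is compact and the set of all finite families of basic sets that cover $\mathcal C$ is recursively enumerable. It is effectively orthogonal if no sequence is uniformly random with respect to two different measures of $\mathcal C$. **Theorem.** Let $\mathcal C\subseteq\mathcal M(\Omega)$ be effectively compact and effectively orthogonal. Then for every $P\in\mathcal C$ and every $\omega\in\Omega$, the sequence $\omega$ is uniformly random with respect to $P$ if and only if it is blindly random with respect to $P$. -/

import Mathlib

open MeasureTheory
open scoped ENNReal NNReal

namespace AlgRandom

/-- The binary Cantor space of infinite binary sequences, with the product topology and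
the product (equivalently, Borel) sigma-algebra. -/
abbrev Cantor : Type := ℕ → Bool

/-- The interval `xΩ`: all sequences that begin with the finite binary word `x`. -/
def cylinder (x : List Bool) : Set Cantor :=
  {ω | ∀ i : Fin x.length, ω i = x.get i}

/-- Rational numbers are presented to algorithms as pairs `(a, b)`, standing for `a / (b + 1)`. -/
def ratVal (q : ℤ × ℕ) : ℚ := (q.1 : ℚ) / ((q.2 : ℚ) + 1)

/-- Nonnegative rational numbers are presented as pairs `(a, b)`, standing for `a / (b + 1)`. -/
def nonnegRatVal (q : ℕ × ℕ) : ℚ≥0 := (q.1 : ℚ≥0) / ((q.2 : ℚ≥0) + 1)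

/-- A single condition `u < P(yΩ) < v` on a measure `P`, given by the word `y` and by the
(codes of) rational numbers `u`, `v`. -/
abbrev Condition : Type := List Bool × (ℤ × ℕ) × (ℤ × ℕ)

/-- The basic set in the space of probability measures given by a finite list of conditions. -/
def basicMeasures (β : List Condition) : Set (ProbabilityMeasure Cantor) :=
  {P | ∀ c ∈ β, ((ratVal c.2.1 : ℚ) : ℝ) < ((P (cylinder c.1) : ℝ≥0) : ℝ) ∧
    ((P (cylinder c.1) : ℝ≥0) : ℝ) < ((ratVal c.2.2 : ℚ) : ℝ)}

/-- The basic open sets `xΩ × β` of the product of Cantor space and the space of measures. -/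
def basicPairs (b : List Bool × List Condition) : Set (Cantor × ProbabilityMeasure Cantor) :=
  cylinder b.1 ×ˢ basicMeasures b.2

/-- `t : X → [0, ∞]` is lower semicomputable with respect to the numbered base `basis`:
the sets `{x | r < t x}` are, uniformly in the rational number `r`, unions of recursively
enumerable families of basic sets. (Since `t` is nonnegative, only `r ≥ 0` matters: for
`r < 0` the set is the whole space.) -/
def LowerSemicomputable {ι X : Type} [Primcodable ι] (basis : ι → Set X) (t : X → ℝ≥0∞) : Prop :=
  ∃ W : (ℕ × ℕ) × ι → Prop, REPred W ∧
    ∀ (q : ℕ × ℕ) (x : X),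
      (((nonnegRatVal q : ℚ≥0) : ℝ≥0) : ℝ≥0∞) < t x ↔ ∃ i, W (q, i) ∧ x ∈ basis i

/-- Uniform tests: lower semicomputable functions `t(ω, P)` of a sequence and a measure with
`∫ t(ω, P) dP(ω) ≤ 1` for every probability measure `P`. -/
def IsUniformTest (t : Cantor × ProbabilityMeasure Cantor → ℝ≥0∞) : Prop :=
  LowerSemicomputable basicPairs t ∧
    ∀ P : ProbabilityMeasure Cantor, ∫⁻ ω, t (ω, P) ∂(P : Measure Cantor) ≤ 1

/-- Universal uniform tests: uniform tests that are maximal up to a constant factor. -/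
def IsUniversalUniformTest (u : Cantor × ProbabilityMeasure Cantor → ℝ≥0∞) : Prop :=
  IsUniformTest u ∧
    ∀ t, IsUniformTest t → ∃ c : ℝ≥0, ∀ z, t z ≤ (c : ℝ≥0∞) * u z

/-- `ω` is uniformly random with respect to `P`: a universal uniform test is finite at `(ω, P)`.
Any two universal uniform tests bound each other up to a constant factor, so the choice of the
universal test is immaterial. -/
def UniformlyRandom (P : ProbabilityMeasure Cantor) (ω : Cantor) : Prop :=
  ∃ u, IsUniversalUniformTest u ∧ u (ω, P) < ∞

/-- The set of sequences that are uniformly random with respect to `P`. -/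
def Randoms (P : ProbabilityMeasure Cantor) : Set Cantor := {ω | UniformlyRandom P ω}

/-- Blind (oracle-free) tests for `P`: lower semicomputable functions `t(ω)`, with no access to
`P`, whose integral with respect to `P` is at most `1`. -/
def IsBlindTest (P : ProbabilityMeasure Cantor) (t : Cantor → ℝ≥0∞) : Prop :=
  LowerSemicomputable cylinder t ∧ ∫⁻ ω, t ω ∂(P : Measure Cantor) ≤ 1

/-- `ω` is blindly random with respect to `P`: every blind test for `P` is finite at `ω`. -/
def BlindlyRandom (P : ProbabilityMeasure Cantor) (ω : Cantor) : Prop :=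
  ∀ t, IsBlindTest P t → t ω < ∞

/-- A class of measures is effectively compact if it is compact (in the weak topology) and the
set of its finite covers by basic sets is recursively enumerable. -/
def EffectivelyCompact (C : Set (ProbabilityMeasure Cantor)) : Prop :=
  IsCompact C ∧ REPred fun S : List (List Condition) => C ⊆ ⋃ β ∈ S, basicMeasures β

/-- A class of measures is effectively orthogonal if no sequence is uniformly random with respect
to two different measures of the class. -/
def EffectivelyOrthogonal (C : Set (ProbabilityMeasure Cantor)) : Prop :=
  ∀ P ∈ C, ∀ Q ∈ C, P ≠ Q → Randoms P ∩ Randoms Q = ∅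

end AlgRandom

/-! Blindly random implies uniformly random: suppose `ω` is not uniformly random for `P`. By
orthogonality it is uniformly random for at most one `Q ∈ C`, and `Q ≠ P`. Remove from `C` a basic
neighbourhood of `Q` that misses `P`. What remains is still effectively compact, contains `P`, and
the universal test is infinite at `(ω, R)` for every `R` in it. Minimizing the universal test over
these `R` gives a function of the sequence alone, lower semicomputable by effective compactness and
below the test for `P`; it is a blind test for `P`, infinite at `ω` (`exists_blindTest`).

Conversely, a blind test for `P`, read as a function of `(ω, R)`, may have a large integral at other
measures. It must be trimmed there without losing its values at `P`. The same trimming yields a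
universal uniform test: each enumeration is cut into finite stages, and a stage counts only near
measures where finitely many rational conditions certify that its integral is at most `2`
(`lintegral_stageFun_le`). An integral at most `1` always produces such a certificate
(`exists_certified`), so `universalTest` dominates, up to constants, every lower semicomputable
function at each measure where its integral is at most `1` (`exists_le_universalTest`). -/

open Encodable
open Nat.Partrec (Code)

/-! ### Closure properties of primitive recursive and recursively enumerable predicates. -/

section Computability

variable {α β : Type*} [Primcodable α] [Primcodable β]

theorem PrimrecPred.forall_mem {f : α → List β} {p : α × β → Prop} (hf : Primrec f)
    (hp : PrimrecPred p) : PrimrecPred fun a => ∀ b ∈ f a, p (a, b) :=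
  (PrimrecRel.forall_mem_list (R := fun b a => p (a, b))
    (hp.comp (Primrec.snd.pair Primrec.fst))).comp hf Primrec.id

theorem PrimrecPred.exists_mem {f : α → List β} {p : α × β → Prop} (hf : Primrec f)
    (hp : PrimrecPred p) : PrimrecPred fun a => ∃ b ∈ f a, p (a, b) :=
  (PrimrecRel.exists_mem_list (R := fun b a => p (a, b))
    (hp.comp (Primrec.snd.pair Primrec.fst))).comp hf Primrec.id

theorem PrimrecPred.rePred_exists {p : α × β → Prop} (hp : PrimrecPred p) :
    REPred fun a => ∃ b, p (a, b) := by
  classical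
  have hf : Primrec₂ fun (a : α) (n : ℕ) =>
      (decode (α := β) n).bind fun b => Option.guard (fun b => p (a, b)) b := by
    refine Primrec.option_bind (Primrec.decode.comp Primrec.snd) ?_
    exact Primrec.option_guard (p := fun (x : (α × ℕ) × β) b => p (x.1.1, b))
      (hp.comp ((Primrec.fst.comp (Primrec.fst.comp Primrec.fst)).pair Primrec.snd)) Primrec.snd
  refine (Partrec.rfindOpt hf.to_comp).dom_re.of_eq fun a => ?_
  rw [Nat.rfindOpt_dom]
  constructor
  · rintro ⟨n, b, hb⟩
    obtain ⟨b', -, hb'⟩ := Option.bind_eq_some_iff.1 hb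
    simp only [Option.guard_eq_some_iff] at hb'
    exact ⟨b, by simpa [hb'.1] using hb'⟩
  · rintro ⟨b, hb⟩
    exact ⟨encode b, b, by simp [hb]⟩

theorem REPred.exists_code {p : α → Prop} (hp : REPred p) :
    ∃ c : Code, ∀ a, p a ↔ ∃ k, (c.evaln k (encode a)).isSome = true := by
  obtain ⟨c, hc⟩ := Nat.Partrec.Code.exists_code.1 hp
  refine ⟨c, fun a => ?_⟩
  have h1 : p a ↔ (c.eval (encode a)).Dom := by
    rw [hc]; simp [Part.assert]
  rw [h1, Part.dom_iff_mem]
  simp only [Nat.Partrec.Code.evaln_complete, Option.isSome_iff_exists, Option.mem_def]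
  exact exists_comm

theorem Nat.Partrec.Code.isSome_evaln_mono {m n : ℕ} (h : m ≤ n) {c : Code} {x : ℕ}
    (hx : (c.evaln m x).isSome = true) : (c.evaln n x).isSome = true := by
  obtain ⟨y, hy⟩ := Option.isSome_iff_exists.1 hx
  exact Option.isSome_iff_exists.2 ⟨y, Nat.Partrec.Code.evaln_mono h hy⟩

theorem Primrec.primrecPred_eq_true {f : α → Bool} (hf : Primrec f) :
    PrimrecPred fun a => f a = true :=
  Primrec.eq.comp hf (Primrec.const true)

/-- Normal form by step-bounded evaluation. The monotonicity in the number of steps lets finitely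
many searches share one bound, as in `REPred.forall_mem`. -/
theorem REPred.exists_primrecPred {p : α → Prop} (hp : REPred p) :
    ∃ r : α × ℕ → Prop, PrimrecPred r ∧ (∀ a m n, m ≤ n → r (a, m) → r (a, n)) ∧
      ∀ a, p a ↔ ∃ n, r (a, n) := by
  obtain ⟨c, hc⟩ := hp.exists_code
  refine ⟨fun x => (c.evaln x.2 (encode x.1)).isSome = true, ?_, ?_, hc⟩
  · apply Primrec.primrecPred_eq_true
    exact Primrec.option_isSome.comp (Nat.Partrec.Code.primrec_evaln.comp
      ((Primrec.snd.pair (Primrec.const c)).pair (Primrec.encode.comp Primrec.fst)))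
  · exact fun a m n h => Nat.Partrec.Code.isSome_evaln_mono h

theorem PrimrecPred.rePred {p : α → Prop} (hp : PrimrecPred p) : REPred p :=
  hp.computablePred.to_re

theorem REPred.comp {p : β → Prop} (hp : REPred p) {f : α → β} (hf : Primrec f) :
    REPred fun a => p (f a) :=
  Partrec.comp hp hf.to_comp

theorem REPred.and {p q : α → Prop} (hp : REPred p) (hq : REPred q) :
    REPred fun a => p a ∧ q a := by
  obtain ⟨r, hr, -, hpr⟩ := hp.exists_primrecPred
  obtain ⟨s, hs, -, hqs⟩ := hq.exists_primrecPred
  refine (PrimrecPred.rePred_exists (β := ℕ × ℕ)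
    (p := fun x => r (x.1, x.2.1) ∧ s (x.1, x.2.2)) ?_).of_eq fun a => ?_
  · exact (hr.comp (Primrec.fst.pair (Primrec.fst.comp Primrec.snd))).and
      (hs.comp (Primrec.fst.pair (Primrec.snd.comp Primrec.snd)))
  · rw [hpr, hqs]
    exact ⟨fun ⟨b, h⟩ => ⟨⟨_, h.1⟩, ⟨_, h.2⟩⟩, fun ⟨⟨m, hm⟩, ⟨n, hn⟩⟩ => ⟨(m, n), hm, hn⟩⟩

theorem REPred.exists {p : α × β → Prop} (hp : REPred p) : REPred fun a => ∃ b, p (a, b) := by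
  obtain ⟨r, hr, -, hpr⟩ := hp.exists_primrecPred
  refine (PrimrecPred.rePred_exists (β := β × ℕ)
    (p := fun x => r ((x.1, x.2.1), x.2.2)) ?_).of_eq fun a => ?_
  · exact hr.comp ((Primrec.fst.pair (Primrec.fst.comp Primrec.snd)).pair
      (Primrec.snd.comp Primrec.snd))
  · simp only [hpr]
    exact ⟨fun ⟨b, h⟩ => ⟨b.1, b.2, h⟩, fun ⟨b, n, h⟩ => ⟨(b, n), h⟩⟩

theorem REPred.forall_mem {p : α × β → Prop} (hp : REPred p) {f : α → List β} (hf : Primrec f) :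
    REPred fun a => ∀ b ∈ f a, p (a, b) := by
  obtain ⟨r, hr, hmono, hpr⟩ := hp.exists_primrecPred
  refine (PrimrecPred.rePred_exists (β := ℕ)
    (p := fun x => ∀ b ∈ f x.1, r ((x.1, b), x.2)) ?_).of_eq fun a => ?_
  · exact PrimrecPred.forall_mem (p := fun y : (α × ℕ) × β => r ((y.1.1, y.2), y.1.2))
      (hf.comp Primrec.fst) (hr.comp (((Primrec.fst.comp Primrec.fst).pair Primrec.snd).pair
        (Primrec.snd.comp Primrec.fst)))
  · simp only [hpr]
    constructor
    · exact fun ⟨n, h⟩ b hb => ⟨n, h b hb⟩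
    · intro h
      choose! g hg using h
      refine ⟨((f a).map g).sum, fun b hb => hmono _ _ _ ?_ (hg b hb)⟩
      exact List.le_sum_of_mem (List.mem_map_of_mem hb)

theorem Primrec.list_sum_nat : Primrec (List.sum : List ℕ → ℕ) :=
  (Primrec.list_foldr (h := fun _ (p : ℕ × ℕ) => p.1 + p.2) Primrec.id (Primrec.const 0)
    ((Primrec.nat_add.comp (Primrec.fst.comp Primrec.snd)
      (Primrec.snd.comp Primrec.snd)).to₂)).of_eq fun l => by
    rfl

theorem Primrec.nat_two_pow : Primrec fun n : ℕ => 2 ^ n :=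
  (Primrec.nat_rec₁ (f := fun _ m => 2 * m) 1
    (Primrec.nat_double.comp Primrec.snd).to₂).of_eq fun n => by
      induction n with
      | zero => rfl
      | succ n ih => rw [pow_succ', ← ih]

theorem Int.encode_natCast (n : ℕ) : encode (n : ℤ) = 2 * n := rfl

theorem Int.encode_negSucc (n : ℕ) : encode (Int.negSucc n) = 2 * n + 1 := rfl

/-- Nonnegative integers have even codes and negative ones odd codes, so parity and halving recover
sign and size. -/
theorem Primrec.int_toNat : Primrec Int.toNat := by
  have h : Primrec fun a : ℤ => bif (encode a).bodd then 0 else (encode a).div2 :=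
    Primrec.cond (Primrec.nat_bodd.comp Primrec.encode) (Primrec.const 0)
      (Primrec.nat_div2.comp Primrec.encode)
  refine h.of_eq fun a => ?_
  cases a with
  | ofNat n => simp [Int.encode_natCast, Nat.div2_val]
  | negSucc n => simp [Int.encode_negSucc]

theorem Primrec.int_neg_toNat : Primrec fun a : ℤ => (-a).toNat := by
  have h : Primrec fun a : ℤ => bif (encode a).bodd then (encode a).div2 + 1 else 0 :=
    Primrec.cond (Primrec.nat_bodd.comp Primrec.encode)
      (Primrec.succ.comp (Primrec.nat_div2.comp Primrec.encode)) (Primrec.const 0)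
  refine h.of_eq fun a => ?_
  cases a with
  | ofNat n => simp [Int.encode_natCast]
  | negSucc n =>
    simp only [Int.encode_negSucc, Nat.div2_val, Int.neg_negSucc, Nat.bodd_add, Nat.bodd_mul]
    simp only [Nat.bodd_two, Bool.false_and, Nat.bodd_one, Bool.false_xor, cond_true,
      Int.toNat_natCast]
    omega

theorem Primrec.list_isPrefix [DecidableEq α] :
    PrimrecPred fun p : List α × List α => p.1 <+: p.2 :=
  (Primrec.eq.comp (Primrec.list_take.comp (Primrec.list_length.comp Primrec.fst) Primrec.snd)
    Primrec.fst).of_eq fun p => by rw [List.prefix_iff_eq_take, eq_comm]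

theorem PrimrecPred.forall_encode_lt {p : α × β → Prop} {f : α → ℕ} (hf : Primrec f)
    (hp : PrimrecPred p) :
    PrimrecPred fun a => ∀ b, encode b < f a → p (a, b) := by
  refine (PrimrecPred.forall_mem (f := fun a => (List.range (f a)).filterMap (decode₂ β)) ?_
    hp).of_eq fun a => ?_
  · exact Primrec.listFilterMap (Primrec.list_range.comp hf)
      ((Primrec.decode₂.comp Primrec.snd).to₂)
  · simp only [List.mem_filterMap, List.mem_range, ← Option.mem_def, mem_decode₂]
    exact ⟨fun h b hb => h b ⟨_, hb, rfl⟩, fun h b ⟨_, hb, hb'⟩ => h b (hb' ▸ hb)⟩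

theorem REPred.or {p q : α → Prop} (hp : REPred p) (hq : REPred q) :
    REPred fun a => p a ∨ q a := by
  obtain ⟨r, hr, -, hpr⟩ := hp.exists_primrecPred
  obtain ⟨s, hs, -, hqs⟩ := hq.exists_primrecPred
  exact (PrimrecPred.rePred_exists (hr.or hs)).of_eq fun a => by rw [hpr, hqs, exists_or]

end Computability

/-- Tracking only integer thresholds of a test costs an additive `1`, so stages may carry natural
number values. -/
theorem ENNReal.le_one_add_of_forall_natCast_lt {a b : ℝ≥0∞}
    (h : ∀ k : ℕ, (k : ℝ≥0∞) < a → k ≤ b) :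
    a ≤ 1 + b := by
  by_contra! H
  have hb : b ≠ ∞ := by
    rintro rfl
    simp at H
  lift b to ℝ≥0 using hb
  have h1 : ((⌊b⌋₊ + 1 : ℕ) : ℝ≥0∞) ≤ 1 + b := by
    have : ((⌊b⌋₊ + 1 : ℕ) : ℝ≥0) ≤ 1 + b := by
      push_cast
      rw [add_comm]
      gcongr
      exact Nat.floor_le zero_le
    exact_mod_cast this
  have h2 : ((⌊b⌋₊ + 1 : ℕ) : ℝ≥0) ≤ b := by exact_mod_cast h _ (h1.trans_lt H)
  exact absurd (Nat.lt_floor_add_one b) (not_lt.2 (by exact_mod_cast h2))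

/-! ### Decidable comparison of coded rationals. -/

namespace AlgRandom

/-- Cross-multiplying and splitting numerators into positive and negative parts leaves only
arithmetic of natural numbers. -/
theorem ratVal_lt_iff (p q : ℤ × ℕ) :
    ratVal p < ratVal q ↔ p.1.toNat * (q.2 + 1) + (-q.1).toNat * (p.2 + 1) <
      q.1.toNat * (p.2 + 1) + (-p.1).toNat * (q.2 + 1) := by
  have hp : p.1 = p.1.toNat - (-p.1).toNat := by omega
  have hq : q.1 = q.1.toNat - (-q.1).toNat := by omega
  rw [ratVal, ratVal, div_lt_div_iff₀ (by positivity) (by positivity)]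
  have : (p.1 : ℚ) * (q.2 + 1) < q.1 * (p.2 + 1) ↔ p.1 * (q.2 + 1) < q.1 * (p.2 + 1) := by
    norm_cast
  rw [this]
  zify
  generalize p.1.toNat = a at *
  generalize (-p.1).toNat = b at *
  generalize q.1.toNat = c at *
  generalize (-q.1).toNat = d at *
  rw [hp, hq]
  constructor <;> intro h <;> linarith

theorem primrecPred_ratVal_lt :
    PrimrecPred fun p : (ℤ × ℕ) × (ℤ × ℕ) => ratVal p.1 < ratVal p.2 := by
  have h1 : Primrec fun p : (ℤ × ℕ) × (ℤ × ℕ) => p.1.1.toNat :=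
    Primrec.int_toNat.comp (Primrec.fst.comp Primrec.fst)
  have h2 : Primrec fun p : (ℤ × ℕ) × (ℤ × ℕ) => (-p.1.1).toNat :=
    Primrec.int_neg_toNat.comp (Primrec.fst.comp Primrec.fst)
  have h3 : Primrec fun p : (ℤ × ℕ) × (ℤ × ℕ) => p.2.1.toNat :=
    Primrec.int_toNat.comp (Primrec.fst.comp Primrec.snd)
  have h4 : Primrec fun p : (ℤ × ℕ) × (ℤ × ℕ) => (-p.2.1).toNat :=
    Primrec.int_neg_toNat.comp (Primrec.fst.comp Primrec.snd)
  have h5 : Primrec fun p : (ℤ × ℕ) × (ℤ × ℕ) => p.1.2 + 1 :=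
    Primrec.succ.comp (Primrec.snd.comp Primrec.fst)
  have h6 : Primrec fun p : (ℤ × ℕ) × (ℤ × ℕ) => p.2.2 + 1 :=
    Primrec.succ.comp (Primrec.snd.comp Primrec.snd)
  refine (Primrec.nat_lt.comp
    (Primrec.nat_add.comp (Primrec.nat_mul.comp h1 h6) (Primrec.nat_mul.comp h4 h5))
    (Primrec.nat_add.comp (Primrec.nat_mul.comp h3 h5) (Primrec.nat_mul.comp h2 h6))).of_eq
      fun p => (ratVal_lt_iff p.1 p.2).symm

theorem nonnegRatVal_lt_iff (p q : ℕ × ℕ) :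
    nonnegRatVal p < nonnegRatVal q ↔ p.1 * (q.2 + 1) < q.1 * (p.2 + 1) := by
  rw [nonnegRatVal, nonnegRatVal, div_lt_div_iff₀ (by positivity) (by positivity)]
  norm_cast

theorem primrecPred_nonnegRatVal_lt :
    PrimrecPred fun p : (ℕ × ℕ) × (ℕ × ℕ) => nonnegRatVal p.1 < nonnegRatVal p.2 :=
  (Primrec.nat_lt.comp
    (Primrec.nat_mul.comp (Primrec.fst.comp Primrec.fst)
      (Primrec.succ.comp (Primrec.snd.comp Primrec.snd)))
    (Primrec.nat_mul.comp (Primrec.fst.comp Primrec.snd)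
      (Primrec.succ.comp (Primrec.snd.comp Primrec.fst)))).of_eq
        fun p => (nonnegRatVal_lt_iff p.1 p.2).symm

theorem exists_ratVal_eq (r : ℚ) : ∃ p, ratVal p = r := by
  refine ⟨(r.num, r.den - 1), ?_⟩
  have h : ((r.den - 1 : ℕ) : ℚ) + 1 = r.den := by
    exact_mod_cast Nat.succ_pred_eq_of_pos r.den_pos
  rw [ratVal, h, Rat.num_div_den]

end AlgRandom

namespace AlgRandom

/-! ### Cylinders and the weak topology on measures. -/

section Cylinder

open Topology

/-- The initial segment of length `n` of a sequence. -/
def initSeg (ω : Cantor) (n : ℕ) : List Bool := (List.range n).map ω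

@[simp] theorem length_initSeg (ω : Cantor) (n : ℕ) : (initSeg ω n).length = n := by
  simp [initSeg]

theorem mem_cylinder_iff {ω : Cantor} {x : List Bool} :
    ω ∈ cylinder x ↔ ∀ i (h : i < x.length), ω i = x[i] :=
  ⟨fun h i hi => h ⟨i, hi⟩, fun h i => h i.1 i.2⟩

theorem mem_cylinder_initSeg (ω : Cantor) (n : ℕ) : ω ∈ cylinder (initSeg ω n) := by
  rw [mem_cylinder_iff]
  simp [initSeg]

theorem mem_cylinder_of_prefix {ω : Cantor} {x w : List Bool} (h : x <+: w)
    (hw : ω ∈ cylinder w) : ω ∈ cylinder x := by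
  rw [mem_cylinder_iff] at *
  intro i hi
  rw [hw i (hi.trans_le h.length_le), h.getElem hi]

theorem prefix_of_mem_cylinder {ω : Cantor} {x w : List Bool} (hx : ω ∈ cylinder x)
    (hw : ω ∈ cylinder w) (h : x.length ≤ w.length) : x <+: w := by
  rw [mem_cylinder_iff] at *
  rw [List.prefix_iff_eq_take]
  refine List.ext_getElem (by simpa using h) fun i h1 h2 => ?_
  rw [List.getElem_take, ← hx i h1, hw i (h1.trans_le h)]

theorem mem_cylinder_nil (ω : Cantor) : ω ∈ cylinder [] := by
  simp [mem_cylinder_iff]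

theorem mem_cylinder_cons {ω : Cantor} {b : Bool} {x : List Bool} :
    ω ∈ cylinder (b :: x) ↔ ω 0 = b ∧ (fun n => ω (n + 1)) ∈ cylinder x := by
  simp only [mem_cylinder_iff, List.length_cons]
  constructor
  · exact fun h => ⟨h 0 (by omega), fun i hi => h (i + 1) (by omega)⟩
  · rintro ⟨h0, h⟩ (_ | i) hi
    · exact h0
    · exact h i (by omega)

theorem isClopen_cylinder (x : List Bool) : IsClopen (cylinder x) := by
  have : cylinder x = ⋂ i : Fin x.length, (fun ω : Cantor => ω i) ⁻¹' {x.get i} := by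
    ext ω; simp [cylinder]
  rw [this]
  exact isClopen_iInter_of_finite fun i => (isClopen_discrete _).preimage (continuous_apply _)

theorem measurableSet_cylinder (x : List Bool) : MeasurableSet (cylinder x) :=
  (isClopen_cylinder x).isOpen.measurableSet

theorem continuous_apply_cylinder (x : List Bool) :
    Continuous fun P : ProbabilityMeasure Cantor => ((P (cylinder x) : ℝ≥0) : ℝ) :=
  NNReal.continuous_coe.comp <| continuous_iff_continuousAt.2 fun _ =>
    ProbabilityMeasure.tendsto_measure_of_isClopen_of_tendsto Filter.tendsto_id
      (isClopen_cylinder x)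

theorem isOpen_basicMeasures (β : List Condition) : IsOpen (basicMeasures β) := by
  have : basicMeasures β = ⋂ c ∈ {c | c ∈ β}, {P : ProbabilityMeasure Cantor |
      ((ratVal c.2.1 : ℚ) : ℝ) < ((P (cylinder c.1) : ℝ≥0) : ℝ) ∧
      ((P (cylinder c.1) : ℝ≥0) : ℝ) < ((ratVal c.2.2 : ℚ) : ℝ)} := by
    ext P; simp [basicMeasures]
  rw [this]
  refine (List.finite_toSet β).isOpen_biInter fun c _ => ?_
  exact (isOpen_lt continuous_const (continuous_apply_cylinder _)).inter
    (isOpen_lt (continuous_apply_cylinder _) continuous_const)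

theorem basicMeasures_anti {β γ : List Condition} (h : β ⊆ γ) :
    basicMeasures γ ⊆ basicMeasures β :=
  fun _ hP c hc => hP c (h hc)

theorem isPiSystem_range_cylinder : IsPiSystem (Set.range cylinder) := by
  rintro _ ⟨x, rfl⟩ _ ⟨y, rfl⟩ ⟨ω, hx, hy⟩
  rcases le_total x.length y.length with h | h
  · refine ⟨y, (Set.inter_eq_right.2 fun z hz => ?_).symm⟩
    exact mem_cylinder_of_prefix (prefix_of_mem_cylinder hx hy h) hz
  · refine ⟨x, (Set.inter_eq_left.2 fun z hz => ?_).symm⟩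
    exact mem_cylinder_of_prefix (prefix_of_mem_cylinder hy hx h) hz

theorem generateFrom_range_cylinder :
    (inferInstance : MeasurableSpace Cantor) =
      MeasurableSpace.generateFrom (Set.range cylinder) := by
  apply le_antisymm
  · refine iSup_le fun i => ?_
    rintro _ ⟨s, -, rfl⟩
    have : (fun ω : Cantor => ω i) ⁻¹' s =
        ⋃ x ∈ {x : List Bool | ∃ h : i < x.length, x[i] ∈ s}, cylinder x := by
      ext ω
      simp only [Set.mem_preimage, Set.mem_iUnion, Set.mem_ofPred_eq]
      constructor
      · intro h
        exact ⟨initSeg ω (i + 1), ⟨by simp, by simpa [initSeg] using h⟩, mem_cylinder_initSeg _ _⟩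
      · rintro ⟨x, ⟨h, hs⟩, hx⟩
        rwa [mem_cylinder_iff.1 hx i h]
    rw [this]
    exact MeasurableSet.biUnion (Set.to_countable _) fun x _ =>
      MeasurableSpace.measurableSet_generateFrom ⟨x, rfl⟩
  · refine MeasurableSpace.generateFrom_le ?_
    rintro _ ⟨x, rfl⟩
    exact measurableSet_cylinder x

/-- Cylinders form a π-system generating the sigma-algebra, hence determine a probability measure.
-/
theorem exists_cylinder_ne {P Q : ProbabilityMeasure Cantor} (h : P ≠ Q) :
    ∃ x, P (cylinder x) ≠ Q (cylinder x) := by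
  by_contra! H
  refine h (Subtype.ext ?_)
  have : IsProbabilityMeasure P.1 := P.2
  refine ext_of_generate_finite _ generateFrom_range_cylinder isPiSystem_range_cylinder ?_ ?_
  · rintro _ ⟨x, rfl⟩
    have := H x
    rw [← ENNReal.coe_inj] at this
    simpa using this
  · have hQ : Q.1 Set.univ = 1 := Q.2.measure_univ
    rw [measure_univ, hQ]

/-- One condition suffices: a rational between the two values of a cylinder separates, and the other
bound is slack. -/
theorem exists_basicMeasures_separating {P Q : ProbabilityMeasure Cantor} (h : P ≠ Q) :
    ∃ β, P ∉ basicMeasures β ∧ Q ∈ basicMeasures β := by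
  obtain ⟨x, hx⟩ := exists_cylinder_ne h
  have hx' : ((P (cylinder x) : ℝ≥0) : ℝ) ≠ ((Q (cylinder x) : ℝ≥0) : ℝ) := by
    exact_mod_cast hx
  rcases hx'.lt_or_gt with h | h
  · obtain ⟨r, h1, h2⟩ := exists_rat_btwn h
    obtain ⟨p, rfl⟩ := exists_ratVal_eq r
    obtain ⟨s, hs⟩ := exists_rat_gt ((Q (cylinder x) : ℝ≥0) : ℝ)
    obtain ⟨p', rfl⟩ := exists_ratVal_eq s
    refine ⟨[(x, p, p')], fun hP => ?_, ?_⟩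
    · exact absurd (hP _ List.mem_cons_self).1 (not_lt.2 h1.le)
    · simpa [basicMeasures] using ⟨h2, hs⟩
  · obtain ⟨r, h1, h2⟩ := exists_rat_btwn h
    obtain ⟨p, rfl⟩ := exists_ratVal_eq r
    obtain ⟨s, hs⟩ := exists_rat_lt ((Q (cylinder x) : ℝ≥0) : ℝ)
    obtain ⟨p', rfl⟩ := exists_ratVal_eq s
    refine ⟨[(x, p', p)], fun hP => ?_, ?_⟩
    · exact absurd (hP _ List.mem_cons_self).2 (not_lt.2 h2.le)
    · simpa [basicMeasures] using ⟨hs, h1⟩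

end Cylinder

/-! ### Lower semicomputable functions as suprema of enumerated values. -/

section Supremum

variable {ι X : Type} {basis : ι → Set X} {V : (ℕ × ℕ) × ι → Prop}

/-- The function whose value at `x` is the supremum of the rationals `q` such that `x` lies in a
basic set listed together with `q` by `V`. -/
noncomputable def supOf (basis : ι → Set X) (V : (ℕ × ℕ) × ι → Prop) (x : X) : ℝ≥0∞ :=
  ⨆ (a : (ℕ × ℕ) × ι) (_ : V a ∧ x ∈ basis a.2), (((nonnegRatVal a.1 : ℚ≥0) : ℝ≥0) : ℝ≥0∞)

theorem lowerSemicomputable_supOf [Primcodable ι] (hV : REPred V) : LowerSemicomputable basis (supOf basis V) := by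
  refine ⟨fun a => ∃ q', V (q', a.2) ∧ nonnegRatVal a.1 < nonnegRatVal q', ?_, fun q x => ?_⟩
  · refine REPred.exists (p := fun b : ((ℕ × ℕ) × ι) × (ℕ × ℕ) =>
      V (b.2, b.1.2) ∧ nonnegRatVal b.1.1 < nonnegRatVal b.2) ?_
    refine (hV.comp (Primrec.snd.pair (Primrec.snd.comp Primrec.fst))).and ?_
    exact (primrecPred_nonnegRatVal_lt.comp
      ((Primrec.fst.comp Primrec.fst).pair Primrec.snd)).rePred
  · simp only [supOf, lt_iSup_iff, exists_prop, Prod.exists]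
    simp only [ENNReal.coe_lt_coe, NNRat.cast_lt]
    grind

theorem le_supOf {x : X} {q : ℕ × ℕ} {i : ι} (h : V (q, i)) (hx : x ∈ basis i) :
    (((nonnegRatVal q : ℚ≥0) : ℝ≥0) : ℝ≥0∞) ≤ supOf basis V x :=
  le_iSup₂_of_le (q, i) ⟨h, hx⟩ le_rfl

theorem supOf_le {x : X} {a : ℝ≥0∞}
    (h : ∀ q i, V (q, i) → x ∈ basis i → (((nonnegRatVal q : ℚ≥0) : ℝ≥0) : ℝ≥0∞) ≤ a) :
    supOf basis V x ≤ a :=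
  iSup₂_le fun b hb => h b.1 b.2 hb.1 hb.2

theorem nonnegRatVal_natCast (k : ℕ) :
    (((nonnegRatVal (k, 0) : ℚ≥0) : ℝ≥0) : ℝ≥0∞) = k := by
  simp [nonnegRatVal]

end Supremum

end AlgRandom

namespace AlgRandom

/-! ### Words of a fixed length and step functions. -/

section Words

/-- The list of all binary words of a given length. -/
def words : ℕ → List (List Bool)
  | 0 => [[]]
  | n + 1 => (words n).map (List.cons false) ++ (words n).map (List.cons true)

theorem primrec_words : Primrec words := by
  refine (Primrec.nat_rec₁ (f := fun _ l => l.map (List.cons false) ++ l.map (List.cons true))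
    [[]] ?_).of_eq fun n => ?_
  · exact (Primrec.list_append.comp
      (Primrec.list_map Primrec.snd
        ((Primrec.list_cons.comp (Primrec.const false) Primrec.snd).to₂))
      (Primrec.list_map Primrec.snd
        ((Primrec.list_cons.comp (Primrec.const true) Primrec.snd).to₂))).to₂
  · induction n with
    | zero => rfl
    | succ n ih => rw [words, ← ih]

theorem initSeg_succ (ω : Cantor) (n : ℕ) :
    initSeg ω (n + 1) = ω 0 :: initSeg (fun n => ω (n + 1)) n := by
  simp [initSeg, List.range_succ_eq_map]

theorem initSeg_mem_words (ω : Cantor) (n : ℕ) : initSeg ω n ∈ words n := by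
  induction n generalizing ω with
  | zero => simp [words, initSeg]
  | succ n ih =>
    rw [initSeg_succ, words]
    cases h : ω 0 <;> simp [ih]

/-- The cylinders of words of length `n` partition the space, so one term survives. -/
theorem sum_indicator_words (f : List Bool → ℝ≥0∞) (n : ℕ) (ω : Cantor) :
    ((words n).map fun w => (cylinder w).indicator (fun _ => f w) ω).sum = f (initSeg ω n) := by
  induction n generalizing f ω with
  | zero => simp [words, initSeg, mem_cylinder_nil]
  | succ n ih =>
    have h : ∀ b, ((words n).map fun w =>
        (cylinder (b :: w)).indicator (fun _ => f (b :: w)) ω).sum =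
          if ω 0 = b then f (b :: initSeg (fun n => ω (n + 1)) n) else 0 := by
      intro b
      split_ifs with hb
      · rw [← ih (fun w => f (b :: w))]
        refine congrArg List.sum (List.map_congr_left fun w _ => ?_)
        classical
        simp only [Set.indicator_apply, mem_cylinder_cons, hb, true_and]
      · simp [mem_cylinder_cons, hb]
    rw [initSeg_succ, words, List.map_append, List.sum_append, List.map_map, List.map_map]
    simp only [Function.comp_def]
    rw [h, h]
    cases ω 0 <;> simp

end Words

/-! ### Shrinking and refuting lists of conditions. -/

section Conditions

/-- Every condition of the second list is implied, with strict inequalities between the bounds,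
by a condition of the first list. -/
def Inside (β' β : List Condition) : Prop :=
  ∀ c ∈ β, ∃ c' ∈ β', c'.1 = c.1 ∧ ratVal c.2.1 < ratVal c'.2.1 ∧ ratVal c'.2.2 < ratVal c.2.2

/-- The measures satisfying the conditions of `β` with nonstrict inequalities. -/
def closedMeasures (β : List Condition) : Set (ProbabilityMeasure Cantor) :=
  {P | ∀ c ∈ β, ((ratVal c.2.1 : ℚ) : ℝ) ≤ ((P (cylinder c.1) : ℝ≥0) : ℝ) ∧
    ((P (cylinder c.1) : ℝ≥0) : ℝ) ≤ ((ratVal c.2.2 : ℚ) : ℝ)}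

theorem Inside.closedMeasures_subset {β' β : List Condition} (h : Inside β' β) :
    closedMeasures β' ⊆ basicMeasures β := by
  intro P hP c hc
  obtain ⟨c', hc', h1, h2, h3⟩ := h c hc
  rw [← h1]
  exact ⟨(Rat.cast_lt.2 h2).trans_le (hP c' hc').1, (hP c' hc').2.trans_lt (Rat.cast_lt.2 h3)⟩

theorem exists_inside {P : ProbabilityMeasure Cantor} {β : List Condition}
    (hP : P ∈ basicMeasures β) : ∃ β', Inside β' β ∧ P ∈ basicMeasures β' := by
  have h : ∀ c ∈ β, ∃ c' : Condition, (c'.1 = c.1 ∧ ratVal c.2.1 < ratVal c'.2.1 ∧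
      ratVal c'.2.2 < ratVal c.2.2) ∧
      ((ratVal c'.2.1 : ℚ) : ℝ) < ((P (cylinder c'.1) : ℝ≥0) : ℝ) ∧
      ((P (cylinder c'.1) : ℝ≥0) : ℝ) < ((ratVal c'.2.2 : ℚ) : ℝ) := by
    intro c hc
    obtain ⟨r, h1, h2⟩ := exists_rat_btwn (hP c hc).1
    obtain ⟨s, h3, h4⟩ := exists_rat_btwn (hP c hc).2
    obtain ⟨r, rfl⟩ := exists_ratVal_eq r
    obtain ⟨s, rfl⟩ := exists_ratVal_eq s
    exact ⟨(c.1, r, s), ⟨rfl, Rat.cast_lt.1 h1, Rat.cast_lt.1 h4⟩, h2, h3⟩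
  choose! f hf hf' using h
  refine ⟨β.map f, fun c hc => ⟨f c, List.mem_map_of_mem hc, hf c hc⟩, fun c' hc' => ?_⟩
  obtain ⟨c, hc, rfl⟩ := List.mem_map.1 hc'
  exact hf' c hc

/-- Some condition of `γ` is incompatible with a condition of `β`. -/
def Refutes (γ β : List Condition) : Prop :=
  ∃ d ∈ γ, ∃ c ∈ β, d.1 = c.1 ∧ (¬ ratVal c.2.1 < ratVal d.2.2 ∨ ¬ ratVal d.2.1 < ratVal c.2.2)

theorem Refutes.notMem {γ β : List Condition} (h : Refutes γ β) {P : ProbabilityMeasure Cantor}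
    (hP : P ∈ basicMeasures γ) : P ∉ basicMeasures β := by
  obtain ⟨d, hd, c, hc, h1, h2⟩ := h
  intro hβ
  have hd' := hP d hd
  have hc' := hβ c hc
  rw [h1] at hd'
  rcases h2 with h2 | h2
  · exact h2 (Rat.cast_lt.1 (hc'.1.trans hd'.2))
  · exact h2 (Rat.cast_lt.1 (hd'.1.trans hc'.2))

/-- Falling outside a closed set is an open condition, visible from finitely many rational bounds.
This is why items carry a shrunken second list: either `P` lies in its closed version, hence in the
original basic set, or the item can be refuted. -/
theorem exists_refutes {P : ProbabilityMeasure Cantor} {β : List Condition}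
    (hP : P ∉ closedMeasures β) : ∃ γ, P ∈ basicMeasures γ ∧ Refutes γ β := by
  have : ∃ c ∈ β, ((P (cylinder c.1) : ℝ≥0) : ℝ) < ((ratVal c.2.1 : ℚ) : ℝ) ∨
      ((ratVal c.2.2 : ℚ) : ℝ) < ((P (cylinder c.1) : ℝ≥0) : ℝ) := by
    by_contra! H
    exact hP H
  obtain ⟨c, hc, h | h⟩ := this
  · obtain ⟨s, hs⟩ := exists_rat_lt ((P (cylinder c.1) : ℝ≥0) : ℝ)
    obtain ⟨p, rfl⟩ := exists_ratVal_eq s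
    refine ⟨[(c.1, p, c.2.1)], ?_, _, List.mem_cons_self, c, hc, rfl, Or.inl (lt_irrefl _)⟩
    simpa [basicMeasures] using ⟨hs, h⟩
  · obtain ⟨s, hs⟩ := exists_rat_gt ((P (cylinder c.1) : ℝ≥0) : ℝ)
    obtain ⟨p, rfl⟩ := exists_ratVal_eq s
    refine ⟨[(c.1, c.2.2, p)], ?_, _, List.mem_cons_self, c, hc, rfl, Or.inr (lt_irrefl _)⟩
    simpa [basicMeasures] using ⟨h, hs⟩

theorem Refutes.mono {γ γ' β : List Condition} (h : Refutes γ β) (hγ : γ ⊆ γ') : Refutes γ' β :=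
  let ⟨d, hd, h⟩ := h
  ⟨d, hγ hd, h⟩

theorem primrecPred_inside :
    PrimrecPred fun p : List Condition × List Condition => Inside p.1 p.2 := by
  refine PrimrecPred.forall_mem (p := fun x : (List Condition × List Condition) × Condition =>
    ∃ c' ∈ x.1.1, c'.1 = x.2.1 ∧ ratVal x.2.2.1 < ratVal c'.2.1 ∧ ratVal c'.2.2 < ratVal x.2.2.2)
    Primrec.snd ?_
  refine PrimrecPred.exists_mem
    (p := fun y : ((List Condition × List Condition) × Condition) × Condition =>
      y.2.1 = y.1.2.1 ∧ ratVal y.1.2.2.1 < ratVal y.2.2.1 ∧ ratVal y.2.2.2 < ratVal y.1.2.2.2)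
    (Primrec.fst.comp Primrec.fst) ?_
  refine PrimrecPred.and ?_ (PrimrecPred.and ?_ ?_)
  · exact Primrec.eq.comp (Primrec.fst.comp Primrec.snd)
      (Primrec.fst.comp (Primrec.snd.comp Primrec.fst))
  · exact primrecPred_ratVal_lt.comp
      (f := fun y : ((List Condition × List Condition) × Condition) × Condition =>
        (y.1.2.2.1, y.2.2.1))
      ((Primrec.fst.comp (Primrec.snd.comp (Primrec.snd.comp Primrec.fst))).pair
        (Primrec.fst.comp (Primrec.snd.comp Primrec.snd)))
  · exact primrecPred_ratVal_lt.comp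
      (f := fun y : ((List Condition × List Condition) × Condition) × Condition =>
        (y.2.2.2, y.1.2.2.2))
      ((Primrec.snd.comp (Primrec.snd.comp Primrec.snd)).pair
        (Primrec.snd.comp (Primrec.snd.comp (Primrec.snd.comp Primrec.fst))))

theorem primrecPred_refutes :
    PrimrecPred fun p : List Condition × List Condition => Refutes p.1 p.2 := by
  refine PrimrecPred.exists_mem (p := fun x : (List Condition × List Condition) × Condition =>
    ∃ c ∈ x.1.2, x.2.1 = c.1 ∧ (¬ ratVal c.2.1 < ratVal x.2.2.2 ∨ ¬ ratVal x.2.2.1 < ratVal c.2.2))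
    Primrec.fst ?_
  refine PrimrecPred.exists_mem
    (p := fun y : ((List Condition × List Condition) × Condition) × Condition =>
      y.1.2.1 = y.2.1 ∧
        (¬ ratVal y.2.2.1 < ratVal y.1.2.2.2 ∨ ¬ ratVal y.1.2.2.1 < ratVal y.2.2.2))
    (Primrec.snd.comp Primrec.fst) ?_
  refine PrimrecPred.and ?_ (PrimrecPred.or (PrimrecPred.not ?_) (PrimrecPred.not ?_))
  · exact Primrec.eq.comp (Primrec.fst.comp (Primrec.snd.comp Primrec.fst))
      (Primrec.fst.comp Primrec.snd)
  · exact primrecPred_ratVal_lt.comp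
      (f := fun y : ((List Condition × List Condition) × Condition) × Condition =>
        (y.2.2.1, y.1.2.2.2))
      ((Primrec.fst.comp (Primrec.snd.comp Primrec.snd)).pair
        (Primrec.snd.comp (Primrec.snd.comp (Primrec.snd.comp Primrec.fst))))
  · exact primrecPred_ratVal_lt.comp
      (f := fun y : ((List Condition × List Condition) × Condition) × Condition =>
        (y.1.2.2.1, y.2.2.2))
      ((Primrec.fst.comp (Primrec.snd.comp (Primrec.snd.comp Primrec.fst))).pair
        (Primrec.snd.comp (Primrec.snd.comp Primrec.snd)))

end Conditions

/-! ### Finite stages, integral certificates and the universal enumeration. -/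

section Stages

/-- A step of a uniform function: a value, a word and two lists of conditions, of which the second
describes a set of measures whose closed version lies inside the first. -/
abbrev Item : Type := ℕ × List Bool × List Condition × List Condition

/-- The item is found within `n` steps in the enumeration with code `e`. -/
def InStage (e n : ℕ) (it : Item) : Prop :=
  -- The bound on the code keeps each stage finite; `(it.1, 0)` codes the integer `it.1`.
  encode it < n ∧ ((Denumerable.ofNat Code e).evaln n
    (encode (((it.1, 0), it.2.1, it.2.2.1) : (ℕ × ℕ) × List Bool × List Condition))).isSome = true ∧
    Inside it.2.2.2 it.2.2.1

theorem InStage.mono {e m n : ℕ} {it : Item} (h : InStage e m it) (hmn : m ≤ n) :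
    InStage e n it :=
  ⟨h.1.trans_le hmn, Nat.Partrec.Code.isSome_evaln_mono hmn h.2.1, h.2.2⟩

theorem primrecPred_inStage : PrimrecPred fun p : (ℕ × ℕ) × Item => InStage p.1.1 p.1.2 p.2 := by
  refine PrimrecPred.and ?_ (PrimrecPred.and ?_ ?_)
  · exact Primrec.nat_lt.comp (Primrec.encode.comp Primrec.snd) (Primrec.snd.comp Primrec.fst)
  · refine Primrec.primrecPred_eq_true (Primrec.option_isSome.comp
      (Nat.Partrec.Code.primrec_evaln.comp (Primrec.pair (Primrec.pair
        (Primrec.snd.comp Primrec.fst)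
        ((Primrec.ofNat Code).comp (Primrec.fst.comp Primrec.fst))) (Primrec.encode.comp ?_))))
    exact ((Primrec.fst.comp Primrec.snd).pair (Primrec.const 0)).pair
      ((Primrec.fst.comp (Primrec.snd.comp Primrec.snd)).pair
        (Primrec.fst.comp (Primrec.snd.comp (Primrec.snd.comp Primrec.snd))))
  · exact primrecPred_inside.comp
      ((Primrec.snd.comp (Primrec.snd.comp (Primrec.snd.comp Primrec.snd))).pair
        (Primrec.fst.comp (Primrec.snd.comp (Primrec.snd.comp Primrec.snd))))

/-- Data certifying a bound for an integral: for every word of a certain length a bound for the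
value of the function on the cylinder and the numerator of a bound for its measure. -/
abbrev Table : Type := List (List Bool × ℕ × ℕ)

/-- The conditions `γ` bound the measure of every `w` in the table `T` as stated there, and the
resulting integral is at most `2`. -/
def TableBound (γ : List Condition) (D : ℕ) (T : Table) (M : ℕ) : Prop :=
  T.map Prod.fst = words D ∧
    (∀ τ ∈ T, ∃ d ∈ γ, d.1 = τ.1 ∧ d.2.2.1.toNat = τ.2.2 ∧ d.2.2.2 = M) ∧
    -- All measure bounds share the denominator `M + 1`, here cleared.
    (T.map fun τ => τ.2.1 * τ.2.2).sum ≤ 2 * (M + 1)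

/-- The table `T` bounds the values of all items in stage `n` that are not refuted by `γ`. -/
def StageBound (e n : ℕ) (γ : List Condition) (D : ℕ) (T : Table) : Prop :=
  ∀ it : Item, encode it < n → (¬ InStage e n it ∨ Refutes γ it.2.2.2 ∨
    (it.2.1.length ≤ D ∧ ∀ τ ∈ T, ¬ it.2.1 <+: τ.1 ∨ it.1 ≤ τ.2.1))

/-- The conditions `γ` imply that the integral of the function given by stage `n` of the
enumeration with code `e` is at most `2`. -/
def Certified (e n : ℕ) (γ : List Condition) : Prop :=
  ∃ D T M, TableBound γ D T M ∧ StageBound e n γ D T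

theorem primrecPred_tableBound :
    PrimrecPred fun p : List Condition × ℕ × Table × ℕ =>
      TableBound p.1 p.2.1 p.2.2.1 p.2.2.2 := by
  have hT : Primrec fun p : List Condition × ℕ × Table × ℕ => p.2.2.1 :=
    Primrec.fst.comp (Primrec.snd.comp Primrec.snd)
  have hM : Primrec fun p : List Condition × ℕ × Table × ℕ => p.2.2.2 :=
    Primrec.snd.comp (Primrec.snd.comp Primrec.snd)
  refine PrimrecPred.and ?_ (PrimrecPred.and ?_ ?_)
  · exact Primrec.eq.comp (Primrec.list_map hT ((Primrec.fst.comp Primrec.snd).to₂))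
      (primrec_words.comp (Primrec.fst.comp Primrec.snd))
  · refine PrimrecPred.forall_mem
      (p := fun x : (List Condition × ℕ × Table × ℕ) × (List Bool × ℕ × ℕ) =>
        ∃ d ∈ x.1.1, d.1 = x.2.1 ∧ d.2.2.1.toNat = x.2.2.2 ∧ d.2.2.2 = x.1.2.2.2) hT ?_
    refine PrimrecPred.exists_mem
      (p := fun y : ((List Condition × ℕ × Table × ℕ) × (List Bool × ℕ × ℕ)) × Condition =>
        y.2.1 = y.1.2.1 ∧ y.2.2.2.1.toNat = y.1.2.2.2 ∧ y.2.2.2.2 = y.1.1.2.2.2)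
        (Primrec.fst.comp Primrec.fst) ?_
    refine PrimrecPred.and ?_ (PrimrecPred.and ?_ ?_)
    · exact Primrec.eq.comp (Primrec.fst.comp Primrec.snd)
        (Primrec.fst.comp (Primrec.snd.comp Primrec.fst))
    · exact Primrec.eq.comp (Primrec.int_toNat.comp
        (Primrec.fst.comp (Primrec.snd.comp (Primrec.snd.comp Primrec.snd))))
        (Primrec.snd.comp (Primrec.snd.comp (Primrec.snd.comp Primrec.fst)))
    · exact Primrec.eq.comp (Primrec.snd.comp (Primrec.snd.comp (Primrec.snd.comp Primrec.snd)))
        (hM.comp (Primrec.fst.comp Primrec.fst))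
  · refine Primrec.nat_le.comp (Primrec.list_sum_nat.comp (Primrec.list_map hT ?_))
      (Primrec.nat_double.comp (Primrec.succ.comp hM))
    exact (Primrec.nat_mul.comp (Primrec.fst.comp (Primrec.snd.comp Primrec.snd))
      (Primrec.snd.comp (Primrec.snd.comp Primrec.snd))).to₂

theorem primrecPred_stageBound :
    PrimrecPred fun p : (ℕ × ℕ) × List Condition × ℕ × Table =>
      StageBound p.1.1 p.1.2 p.2.1 p.2.2.1 p.2.2.2 := by
  refine PrimrecPred.forall_encode_lt
    (p := fun x : ((ℕ × ℕ) × List Condition × ℕ × Table) × Item =>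
      ¬ InStage x.1.1.1 x.1.1.2 x.2 ∨ Refutes x.1.2.1 x.2.2.2.2 ∨
        (x.2.2.1.length ≤ x.1.2.2.1 ∧ ∀ τ ∈ x.1.2.2.2, ¬ x.2.2.1 <+: τ.1 ∨ x.2.1 ≤ τ.2.1))
    (Primrec.snd.comp Primrec.fst) ?_
  refine PrimrecPred.or (PrimrecPred.not ?_) (PrimrecPred.or ?_ (PrimrecPred.and ?_ ?_))
  · exact primrecPred_inStage.comp ((Primrec.fst.comp Primrec.fst).pair Primrec.snd)
  · exact primrecPred_refutes.comp ((Primrec.fst.comp (Primrec.snd.comp Primrec.fst)).pair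
      (Primrec.snd.comp (Primrec.snd.comp (Primrec.snd.comp Primrec.snd))))
  · exact Primrec.nat_le.comp (Primrec.list_length.comp
      (Primrec.fst.comp (Primrec.snd.comp Primrec.snd)))
      (Primrec.fst.comp (Primrec.snd.comp (Primrec.snd.comp Primrec.fst)))
  · refine PrimrecPred.forall_mem
      (p := fun y : (((ℕ × ℕ) × List Condition × ℕ × Table) × Item) × (List Bool × ℕ × ℕ) =>
        ¬ y.1.2.2.1 <+: y.2.1 ∨ y.1.2.1 ≤ y.2.2.1)
      (Primrec.snd.comp (Primrec.snd.comp (Primrec.snd.comp Primrec.fst))) ?_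
    refine PrimrecPred.or (PrimrecPred.not ?_) ?_
    · exact Primrec.list_isPrefix.comp
        ((Primrec.fst.comp (Primrec.snd.comp (Primrec.snd.comp Primrec.fst))).pair
          (Primrec.fst.comp Primrec.snd))
    · exact Primrec.nat_le.comp (Primrec.fst.comp (Primrec.snd.comp Primrec.fst))
        (Primrec.fst.comp (Primrec.snd.comp Primrec.snd))

theorem rePred_certified :
    REPred fun p : (ℕ × ℕ) × List Condition => Certified p.1.1 p.1.2 p.2 := by
  refine (PrimrecPred.rePred_exists (β := ℕ × Table × ℕ)
    (p := fun x : ((ℕ × ℕ) × List Condition) × (ℕ × Table × ℕ) =>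
      TableBound x.1.2 x.2.1 x.2.2.1 x.2.2.2 ∧ StageBound x.1.1.1 x.1.1.2 x.1.2 x.2.1 x.2.2.1)
    ?_).of_eq fun p => ?_
  · refine PrimrecPred.and ?_ ?_
    · exact primrecPred_tableBound.comp ((Primrec.snd.comp Primrec.fst).pair Primrec.snd)
    · exact primrecPred_stageBound.comp ((Primrec.fst.comp Primrec.fst).pair
        ((Primrec.snd.comp Primrec.fst).pair ((Primrec.fst.comp Primrec.snd).pair
          (Primrec.fst.comp (Primrec.snd.comp Primrec.snd)))))
  · simp only [Certified, Prod.exists]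

/-- The enumeration defining the universal uniform test. -/
def UniversalEnum (a : (ℕ × ℕ) × List Bool × List Condition) : Prop :=
  -- The code `(1, 1)` is the constant `1/2`, a positive floor for the test. Items of enumeration
  -- `e` get weight `2 ^ (-(e + 3))`; integrals at most `2` then add up to `1/2`.
  a.1 = (1, 1) ∨ ∃ e n, ∃ it : Item, (InStage e n it ∧ (∀ c ∈ it.2.2.2, c ∈ a.2.2) ∧
    a.2.1 = it.2.1 ∧ a.1 = (it.1, 2 ^ (e + 3) - 1)) ∧ Certified e n a.2.2

theorem primrec_two_pow_sub_one : Primrec fun e : ℕ => 2 ^ (e + 3) - 1 :=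
  Primrec.nat_sub.comp (Primrec.nat_two_pow.comp
    (Primrec.nat_add.comp Primrec.id (Primrec.const 3))) (Primrec.const 1)

theorem rePred_universalEnum : REPred UniversalEnum := by
  refine REPred.or (Primrec.eq.comp Primrec.fst (Primrec.const (1, 1))).rePred ?_
  refine (REPred.exists (β := ℕ × ℕ × Item)
    (p := fun x : ((ℕ × ℕ) × List Bool × List Condition) × (ℕ × ℕ × Item) =>
      (InStage x.2.1 x.2.2.1 x.2.2.2 ∧ (∀ c ∈ x.2.2.2.2.2.2, c ∈ x.1.2.2) ∧
        x.1.2.1 = x.2.2.2.2.1 ∧ x.1.1 = (x.2.2.2.1, 2 ^ (x.2.1 + 3) - 1)) ∧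
        Certified x.2.1 x.2.2.1 x.1.2.2) ?_).of_eq fun a => ?_
  · have hit : Primrec fun x : ((ℕ × ℕ) × List Bool × List Condition) × (ℕ × ℕ × Item) =>
        x.2.2.2 := Primrec.snd.comp (Primrec.snd.comp Primrec.snd)
    have hen : Primrec fun x : ((ℕ × ℕ) × List Bool × List Condition) × (ℕ × ℕ × Item) =>
        (x.2.1, x.2.2.1) := (Primrec.fst.comp Primrec.snd).pair
          (Primrec.fst.comp (Primrec.snd.comp Primrec.snd))
    have hγ : Primrec fun x : ((ℕ × ℕ) × List Bool × List Condition) × (ℕ × ℕ × Item) =>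
        x.1.2.2 := Primrec.snd.comp (Primrec.snd.comp Primrec.fst)
    refine REPred.and (PrimrecPred.rePred ?_) (rePred_certified.comp
      (f := fun x : ((ℕ × ℕ) × List Bool × List Condition) × (ℕ × ℕ × Item) =>
        ((x.2.1, x.2.2.1), x.1.2.2)) (hen.pair hγ))
    refine PrimrecPred.and (primrecPred_inStage.comp
      (f := fun x : ((ℕ × ℕ) × List Bool × List Condition) × (ℕ × ℕ × Item) =>
        ((x.2.1, x.2.2.1), x.2.2.2)) (hen.pair hit)) (PrimrecPred.and ?_
      (PrimrecPred.and ?_ ?_))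
    · refine (PrimrecPred.forall_mem
        (p := fun y : (((ℕ × ℕ) × List Bool × List Condition) × (ℕ × ℕ × Item)) × Condition =>
          ∃ d ∈ y.1.1.2.2, d = y.2)
        (Primrec.snd.comp (Primrec.snd.comp (Primrec.snd.comp hit)))
        (PrimrecPred.exists_mem
          (p := fun z : ((((ℕ × ℕ) × List Bool × List Condition) × (ℕ × ℕ × Item)) × Condition) ×
            Condition => z.2 = z.1.2) (hγ.comp Primrec.fst)
          (Primrec.eq.comp Primrec.snd (Primrec.snd.comp Primrec.fst)))).of_eq fun x => by simp
    · exact Primrec.eq.comp (Primrec.fst.comp (Primrec.snd.comp Primrec.fst))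
        (Primrec.fst.comp (Primrec.snd.comp hit))
    · exact Primrec.eq.comp (Primrec.fst.comp Primrec.fst) ((Primrec.fst.comp hit).pair
        (primrec_two_pow_sub_one.comp (Primrec.fst.comp Primrec.snd)))
  · simp only [Prod.exists]

end Stages

end AlgRandom

/-! ### The universal uniform test and the comparison of the two notions. -/

namespace AlgRandom

theorem basicMeasures_append (β γ : List Condition) :
    basicMeasures (β ++ γ) = basicMeasures β ∩ basicMeasures γ := by
  ext P
  simp only [basicMeasures, List.mem_append, or_imp, forall_and, Set.mem_ofPred_eq,
    Set.mem_inter_iff]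
  tauto

theorem lintegral_list_sum_indicator {α : Type*} (μ : Measure Cantor) (l : List α)
    (w : α → List Bool) (k : α → ℝ≥0∞) :
    ∫⁻ ω, (l.map fun a => (cylinder (w a)).indicator (fun _ => k a) ω).sum ∂μ =
      (l.map fun a => k a * μ (cylinder (w a))).sum := by
  induction l with
  | nil => simp
  | cons a l ih =>
    simp only [List.map_cons, List.sum_cons]
    rw [lintegral_add_left (measurable_const.indicator (measurableSet_cylinder _)), ih,
      lintegral_indicator_const (measurableSet_cylinder _)]

/-- The function of a sequence given by the items of stage `n` that apply to the measure `P`. -/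
noncomputable def stageFun (P : ProbabilityMeasure Cantor) (e n : ℕ) (ω : Cantor) : ℝ≥0∞ :=
  ⨆ (it : Item) (_ : InStage e n it ∧ P ∈ basicMeasures it.2.2.2),
    (cylinder it.2.1).indicator (fun _ => (it.1 : ℝ≥0∞)) ω

theorem measurable_stageFun (P : ProbabilityMeasure Cantor) (e n : ℕ) :
    Measurable (stageFun P e n) :=
  Measurable.iSup fun _ => Measurable.iSup fun _ =>
    measurable_const.indicator (measurableSet_cylinder _)

theorem stageFun_mono (P : ProbabilityMeasure Cantor) (e : ℕ) : Monotone (stageFun P e) :=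
  fun _ _ h _ => iSup_mono fun _ => iSup_mono' fun hit => ⟨⟨hit.1.mono h, hit.2⟩, le_rfl⟩

/-- Items refuted by `γ` do not apply to `P`; the others lie below the step function of the table,
whose integral is a finite sum. -/
theorem lintegral_stageFun_le {P : ProbabilityMeasure Cantor} {e n : ℕ} {γ : List Condition}
    (hP : P ∈ basicMeasures γ) (h : Certified e n γ) :
    ∫⁻ ω, stageFun P e n ω ∂(P : Measure Cantor) ≤ 2 := by
  obtain ⟨D, T, M, ⟨hwords, hmeas, hsum⟩, hstage⟩ := h
  have h1 : ∀ ω, stageFun P e n ω ≤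
      (T.map fun τ => (cylinder τ.1).indicator (fun _ => (τ.2.1 : ℝ≥0∞)) ω).sum := by
    intro ω
    refine iSup₂_le fun it hit => ?_
    by_cases hω : ω ∈ cylinder it.2.1
    · rw [Set.indicator_of_mem hω]
      have hw := initSeg_mem_words ω D
      rw [← hwords, List.mem_map] at hw
      obtain ⟨τ, hτ, hτw⟩ := hw
      rcases hstage it hit.1.1 with h | h | ⟨hlen, h⟩
      · exact absurd hit.1 h
      · exact absurd hit.2 (h.notMem hP)
      · have hpre : it.2.1 <+: τ.1 := by
          rw [hτw]
          exact prefix_of_mem_cylinder hω (mem_cylinder_initSeg _ _) (by simpa using hlen)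
        have hle : it.1 ≤ τ.2.1 := (h τ hτ).resolve_left (not_not.2 hpre)
        refine le_trans ?_ (List.le_sum_of_mem (List.mem_map_of_mem hτ))
        rw [Set.indicator_of_mem (by rw [hτw]; exact mem_cylinder_initSeg _ _)]
        exact_mod_cast hle
    · rw [Set.indicator_of_notMem hω]
      exact zero_le
  refine (lintegral_mono h1).trans ?_
  rw [lintegral_list_sum_indicator]
  have h2 : ((M : ℝ≥0∞) + 1) *
      (T.map fun τ => (τ.2.1 : ℝ≥0∞) * (P : Measure Cantor) (cylinder τ.1)).sum ≤
      (T.map fun τ => ((τ.2.1 * τ.2.2 : ℕ) : ℝ≥0∞)).sum := by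
    rw [← List.sum_map_mul_left]
    refine List.sum_le_sum fun τ hτ => ?_
    obtain ⟨d, hd, h1, h2, h3⟩ := hmeas τ hτ
    have hlt := (hP d hd).2
    rw [h1, ratVal, h3] at hlt
    have hle : (P (cylinder τ.1) : ℝ≥0) * ((M : ℝ≥0) + 1) ≤ τ.2.2 := by
      rw [← NNReal.coe_le_coe]
      push_cast at hlt ⊢
      rw [lt_div_iff₀ (by positivity)] at hlt
      refine hlt.le.trans ?_
      rw [← h2]
      exact_mod_cast Int.self_le_toNat d.2.2.1
    have hle' : (P : Measure Cantor) (cylinder τ.1) * ((M : ℝ≥0∞) + 1) ≤ τ.2.2 := by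
      rw [← ProbabilityMeasure.ennreal_coeFn_eq_coeFn_toMeasure]
      exact_mod_cast hle
    calc ((M : ℝ≥0∞) + 1) * (τ.2.1 * (P : Measure Cantor) (cylinder τ.1))
        = τ.2.1 * ((P : Measure Cantor) (cylinder τ.1) * (M + 1)) := by ring
      _ ≤ τ.2.1 * τ.2.2 := by gcongr
      _ = _ := by push_cast; rfl
  have h3 : (T.map fun τ => ((τ.2.1 * τ.2.2 : ℕ) : ℝ≥0∞)).sum ≤ ((M : ℝ≥0∞) + 1) * 2 := by
    have : (T.map fun τ => ((τ.2.1 * τ.2.2 : ℕ) : ℝ≥0∞)).sum =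
        (((T.map fun τ => τ.2.1 * τ.2.2).sum : ℕ) : ℝ≥0∞) := by
      rw [Nat.cast_list_sum, List.map_map]; rfl
    rw [this, mul_comm]
    exact_mod_cast hsum
  refine (ENNReal.mul_le_mul_iff_right ?_ ?_).1 (h2.trans h3)
  · simp
  · exact_mod_cast ENNReal.natCast_ne_top (M + 1)

theorem nonnegRatVal_two_pow (k e : ℕ) :
    (((nonnegRatVal (k, 2 ^ e - 1) : ℚ≥0) : ℝ≥0) : ℝ≥0∞) = (2⁻¹ : ℝ≥0∞) ^ e * k := by
  have h : ((2 ^ e - 1 : ℕ) : ℚ≥0) + 1 = 2 ^ e := by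
    exact_mod_cast Nat.sub_add_cancel Nat.one_le_two_pow
  rw [nonnegRatVal, h]
  push_cast
  rw [ENNReal.div_eq_inv_mul, ENNReal.inv_pow]

/-- The universal uniform test. -/
noncomputable def universalTest : Cantor × ProbabilityMeasure Cantor → ℝ≥0∞ :=
  supOf basicPairs UniversalEnum

theorem tsum_inv_two_pow_add_three : ∑' e : ℕ, (2⁻¹ : ℝ≥0∞) ^ (e + 3) * 2 = 2⁻¹ := by
  have : ∀ e : ℕ, (2⁻¹ : ℝ≥0∞) ^ (e + 3) * 2 = 2⁻¹ ^ e * 2⁻¹ ^ 2 := by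
    intro e
    rw [pow_succ _ (e + 2), mul_assoc, ENNReal.inv_mul_cancel (by simp) (by simp), mul_one, pow_add]
  simp_rw [this]
  rw [ENNReal.tsum_mul_right, ENNReal.tsum_geometric, ENNReal.one_sub_inv_two, inv_inv, pow_two,
    ← mul_assoc, ENNReal.mul_inv_cancel (by simp) (by simp), one_mul]

/-- For fixed `e` and `P` the certified stages form a chain, so the bound `2` passes to their
supremum by directed convergence. -/
theorem isUniformTest_universalTest : IsUniformTest universalTest := by
  refine ⟨lowerSemicomputable_supOf rePred_universalEnum, fun P => ?_⟩
  let S : ℕ → Cantor → ℝ≥0∞ := fun e ω =>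
    ⨆ n : {n // ∃ γ, P ∈ basicMeasures γ ∧ Certified e n γ}, stageFun P e n ω
  have hSm : ∀ e, Measurable (S e) := fun e => Measurable.iSup fun n => measurable_stageFun P e n
  have hS : ∀ e, ∫⁻ ω, S e ω ∂(P : Measure Cantor) ≤ 2 := by
    intro e
    change ∫⁻ ω, ⨆ n : {n // ∃ γ, P ∈ basicMeasures γ ∧ Certified e n γ}, stageFun P e n ω
      ∂(P : Measure Cantor) ≤ 2
    rw [lintegral_iSup_directed (f := fun n : {n // ∃ γ, P ∈ basicMeasures γ ∧ Certified e n γ} =>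
      stageFun P e n) (fun n => (measurable_stageFun P e n).aemeasurable)]
    · refine iSup_le fun n => ?_
      obtain ⟨γ, hP, hγ⟩ := n.2
      exact lintegral_stageFun_le hP hγ
    · intro m n
      rcases le_total m.1 n.1 with h | h
      · exact ⟨n, stageFun_mono P e h, le_rfl⟩
      · exact ⟨m, le_rfl, stageFun_mono P e h⟩
  have hle : ∀ ω, universalTest (ω, P) ≤ 2⁻¹ + ∑' e, (2⁻¹ : ℝ≥0∞) ^ (e + 3) * S e ω := by
    intro ω
    refine supOf_le fun q b hV hb => ?_
    rcases hV with hq | ⟨e, n, it, ⟨hit, hsub, hx, hq⟩, hcert⟩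
    · refine le_trans (le_of_eq ?_) le_self_add
      change q = _ at hq
      rw [hq]
      simpa using nonnegRatVal_two_pow 1 1
    · refine le_trans ?_ (le_trans (ENNReal.le_tsum e) le_add_self)
      change q = _ at hq
      change b.1 = _ at hx
      rw [hq, nonnegRatVal_two_pow]
      gcongr
      refine le_trans ?_ (le_iSup (fun n : {n // ∃ γ, P ∈ basicMeasures γ ∧ Certified e n γ} =>
        stageFun P e n ω) ⟨n, b.2, hb.2, hcert⟩)
      refine le_trans ?_ (le_iSup₂ it ⟨hit, basicMeasures_anti hsub hb.2⟩)
      rw [Set.indicator_of_mem (by rw [← hx]; exact hb.1)]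
  calc ∫⁻ ω, universalTest (ω, P) ∂(P : Measure Cantor)
      ≤ ∫⁻ ω, 2⁻¹ + ∑' e, (2⁻¹ : ℝ≥0∞) ^ (e + 3) * S e ω ∂(P : Measure Cantor) :=
        lintegral_mono hle
    _ = 2⁻¹ + ∑' e, (2⁻¹ : ℝ≥0∞) ^ (e + 3) * ∫⁻ ω, S e ω ∂(P : Measure Cantor) := by
        rw [lintegral_add_left measurable_const, lintegral_const, measure_univ, mul_one,
          lintegral_tsum fun e => ((hSm e).const_mul _).aemeasurable]
        simp_rw [lintegral_const_mul _ (hSm _)]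
    _ ≤ 2⁻¹ + ∑' e : ℕ, (2⁻¹ : ℝ≥0∞) ^ (e + 3) * 2 := by
        gcongr with e
        exact hS e
    _ = 1 := by rw [tsum_inv_two_pow_add_three, ENNReal.inv_two_add_inv_two]

theorem Certified.mono {e n : ℕ} {γ γ' : List Condition} (h : Certified e n γ) (hγ : γ ⊆ γ') :
    Certified e n γ' := by
  obtain ⟨D, T, M, ⟨h1, h2, h3⟩, h4⟩ := h
  refine ⟨D, T, M, ⟨h1, fun τ hτ => ?_, h3⟩, fun it hit => ?_⟩
  · obtain ⟨d, hd, h⟩ := h2 τ hτ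
    exact ⟨d, hγ hd, h⟩
  · exact (h4 it hit).imp_right (Or.imp_left fun h => h.mono hγ)

/-- The gap between `1` and `2` absorbs the error of replacing measures of cylinders by strict
rational upper bounds, so the certificate can be an open condition satisfied by `P`. -/
theorem exists_certified {P : ProbabilityMeasure Cantor} {e n : ℕ} {f : Cantor → ℝ≥0∞}
    (hf : ∫⁻ ω, f ω ∂(P : Measure Cantor) ≤ 1)
    (hfit : ∀ it, InStage e n it → P ∈ closedMeasures it.2.2.2 →
      ∀ ω ∈ cylinder it.2.1, (it.1 : ℝ≥0∞) ≤ f ω) :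
    ∃ γ, P ∈ basicMeasures γ ∧ Certified e n γ := by
  classical
  have hfin : {it : Item | encode it < n}.Finite :=
    (Set.finite_lt_nat n).preimage encode_injective.injOn
  set l : Finset Item := hfin.toFinset with hl
  have hmem : ∀ it : Item, it ∈ l ↔ encode it < n := fun it => by simp [hl]
  have hR : ∀ it : Item, ∃ γ, P ∈ basicMeasures γ ∧
      (P ∉ closedMeasures it.2.2.2 → Refutes γ it.2.2.2) := by
    intro it
    by_cases h : P ∈ closedMeasures it.2.2.2
    · exact ⟨[], by simp [basicMeasures], fun h' => absurd h h'⟩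
    · obtain ⟨γ, h1, h2⟩ := exists_refutes h
      exact ⟨γ, h1, fun _ => h2⟩
  choose R hRP hR using hR
  let D : ℕ := l.sup fun it => it.2.1.length
  let K : List Bool → ℕ := fun w =>
    (l.filter fun it => InStage e n it ∧ P ∈ closedMeasures it.2.2.2 ∧ it.2.1 <+: w).sup Prod.fst
  have hK : ∀ w, ∀ ω ∈ cylinder w, (K w : ℝ≥0∞) ≤ f ω := by
    intro w ω hω
    refine Finset.sup_induction (p := fun k : ℕ => (k : ℝ≥0∞) ≤ f ω) (by simp) ?_ ?_
    · intro a ha b hb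
      rcases le_total a b with h | h <;> simpa [h]
    · intro it hit
      obtain ⟨-, h1, h2, h3⟩ := Finset.mem_filter.1 hit
      exact hfit it h1 h2 ω (mem_cylinder_of_prefix h3 hω)
  -- Rounding a measure up to a multiple of `1 / (M + 1)` costs at most `1 / (M + 1)`; weighted by
  -- the values `K w`, the total error is at most `M / (M + 1) < 1`. The `+ 1` in `J` makes the
  -- bound strict.
  let M : ℕ := ((words D).map K).sum
  let J : List Bool → ℕ := fun w => ⌊P (cylinder w) * ((M : ℝ≥0) + 1)⌋₊ + 1
  have hsum :
      ((words D).map fun w => (K w : ℝ≥0∞) * (P : Measure Cantor) (cylinder w)).sum ≤ 1 := by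
    rw [← lintegral_list_sum_indicator (w := fun w => w)]
    refine (lintegral_mono fun ω => ?_).trans hf
    rw [sum_indicator_words fun w => (K w : ℝ≥0∞)]
    exact hK _ ω (mem_cylinder_initSeg _ _)
  have hKJ : ((words D).map fun w => K w * J w).sum ≤ 2 * (M + 1) := by
    have h1 : ((((words D).map fun w => K w * J w).sum : ℕ) : ℝ≥0∞) ≤
        ((words D).map fun w =>
          (K w : ℝ≥0∞) * (P : Measure Cantor) (cylinder w) * ((M : ℝ≥0∞) + 1) + K w).sum := by
      rw [Nat.cast_list_sum, List.map_map]
      refine List.sum_le_sum fun w _ => ?_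
      have hJ : ((J w : ℕ) : ℝ≥0) ≤ P (cylinder w) * ((M : ℝ≥0) + 1) + 1 := by
        simp only [J]
        push_cast
        gcongr
        exact Nat.floor_le zero_le
      have hJ' : ((J w : ℕ) : ℝ≥0∞) ≤ (P : Measure Cantor) (cylinder w) * ((M : ℝ≥0∞) + 1) + 1 := by
        rw [← ProbabilityMeasure.ennreal_coeFn_eq_coeFn_toMeasure]
        exact_mod_cast hJ
      calc ((K w * J w : ℕ) : ℝ≥0∞) = K w * J w := by push_cast; rfl
        _ ≤ K w * ((P : Measure Cantor) (cylinder w) * ((M : ℝ≥0∞) + 1) + 1) := by gcongr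
        _ = _ := by ring
    rw [List.sum_map_add, List.sum_map_mul_right] at h1
    have h2 : ((words D).map fun w => (K w : ℝ≥0∞)).sum = M := by
      simp only [M]
      rw [Nat.cast_list_sum, List.map_map]
      rfl
    rw [h2] at h1
    have h3 : ((((words D).map fun w => K w * J w).sum : ℕ) : ℝ≥0∞) ≤ 1 * ((M : ℝ≥0∞) + 1) + M :=
      h1.trans (by gcongr)
    have h4 : ((words D).map fun w => K w * J w).sum ≤ 1 * (M + 1) + M := by exact_mod_cast h3
    omega
  -- The lower bound `-1` is vacuous.
  refine ⟨l.toList.flatMap R ++ (words D).map fun w => (w, (-1, 0), ((J w : ℤ), M)), ?_, D,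
    (words D).map fun w => (w, K w, J w), M, ⟨?_, ?_, ?_⟩, ?_⟩
  · rw [basicMeasures_append]
    refine ⟨fun c hc => ?_, fun c hc => ?_⟩
    · obtain ⟨it, -, hit⟩ := List.mem_flatMap.1 hc
      exact hRP it c hit
    · obtain ⟨w, -, rfl⟩ := List.mem_map.1 hc
      constructor
      · refine lt_of_lt_of_le ?_ (NNReal.coe_nonneg _)
        norm_num [ratVal]
      · have := Nat.lt_floor_add_one (P (cylinder w) * ((M : ℝ≥0) + 1))
        rw [ratVal]
        push_cast
        rw [lt_div_iff₀ (by positivity)]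
        have h' : ((P (cylinder w) * ((M : ℝ≥0) + 1) : ℝ≥0) : ℝ) < ((J w : ℝ≥0) : ℝ) := by
          rw [NNReal.coe_lt_coe]
          simpa [J] using this
        simpa using h'
  · rw [List.map_map]
    exact List.map_id _
  · intro τ hτ
    obtain ⟨w, hw, rfl⟩ := List.mem_map.1 hτ
    exact ⟨_, List.mem_append_right _ (List.mem_map_of_mem hw), rfl, by simp, rfl⟩
  · rw [List.map_map]
    exact hKJ
  · intro it hit
    by_cases h1 : InStage e n it
    swap
    · exact Or.inl h1
    by_cases h2 : P ∈ closedMeasures it.2.2.2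
    swap
    · refine Or.inr (Or.inl ((hR it h2).mono fun c hc => List.mem_append_left _ ?_))
      exact List.mem_flatMap.2 ⟨it, by simpa [hmem] using hit, hc⟩
    refine Or.inr (Or.inr ⟨?_, fun τ hτ => ?_⟩)
    · exact Finset.le_sup (f := fun it : Item => it.2.1.length) ((hmem it).2 hit)
    · obtain ⟨w, hw, rfl⟩ := List.mem_map.1 hτ
      by_cases h3 : it.2.1 <+: w
      · exact Or.inr (Finset.le_sup (f := Prod.fst)
          (Finset.mem_filter.2 ⟨(hmem it).2 hit, h1, h2, h3⟩))
      · exact Or.inl h3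

/-- The integral bound is needed only at the measure considered, because certificates are local; the
constant depends on the enumeration alone. -/
theorem LowerSemicomputable.exists_le_universalTest
    {t : Cantor × ProbabilityMeasure Cantor → ℝ≥0∞} (ht : LowerSemicomputable basicPairs t) :
    ∃ e : ℕ, ∀ (P : ProbabilityMeasure Cantor) (ω : Cantor),
      ∫⁻ ω, t (ω, P) ∂(P : Measure Cantor) ≤ 1 →
        t (ω, P) ≤ 1 + 2 ^ e * universalTest (ω, P) := by
  obtain ⟨W, hW, htW⟩ := ht
  obtain ⟨c, hc⟩ := hW.exists_code
  have hsound : ∀ n it, InStage (encode c) n it → W ((it.1, 0), it.2.1, it.2.2.1) := by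
    intro n it h
    refine (hc _).2 ⟨n, ?_⟩
    simpa using h.2.1
  refine ⟨encode c + 3, fun P ω hP => ENNReal.le_one_add_of_forall_natCast_lt fun k hk => ?_⟩
  obtain ⟨⟨x, β⟩, hWk, hx, hβ⟩ := (htW (k, 0) (ω, P)).1 (by rwa [nonnegRatVal_natCast])
  obtain ⟨β', hin, hβ'⟩ := exists_inside hβ
  obtain ⟨m, hm⟩ := (hc _).1 hWk
  set it : Item := (k, x, β, β')
  have hit : InStage (encode c) (max m (encode it + 1)) it := by
    refine ⟨lt_of_lt_of_le (Nat.lt_succ_self _) (le_max_right _ _), ?_, hin⟩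
    refine Nat.Partrec.Code.isSome_evaln_mono (le_max_left _ _) ?_
    simpa using hm
  obtain ⟨γ, hγ, hcert⟩ := exists_certified (e := encode c) (n := max m (encode it + 1)) hP (by
    intro it' hit' hP' ω' hω'
    have := (htW (it'.1, 0) (ω', P)).2
      ⟨_, hsound _ _ hit', hω', hit'.2.2.closedMeasures_subset hP'⟩
    rw [nonnegRatVal_natCast] at this
    exact this.le)
  -- `β'` makes the item apply and `γ` certifies its stage.
  have hV : UniversalEnum ((k, 2 ^ (encode c + 3) - 1), x, β' ++ γ) :=
    Or.inr ⟨_, _, it, ⟨hit, fun d hd => List.mem_append_left _ hd, rfl, rfl⟩,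
      hcert.mono (List.subset_append_right _ _)⟩
  have hle : _ ≤ universalTest (ω, P) := le_supOf (basis := basicPairs) (x := (ω, P)) hV
    ⟨hx, by rw [basicMeasures_append]; exact ⟨hβ', hγ⟩⟩
  rw [nonnegRatVal_two_pow] at hle
  calc (k : ℝ≥0∞) = 2 ^ (encode c + 3) * (2⁻¹ ^ (encode c + 3) * k) := by
        rw [← mul_assoc, ← mul_pow, ENNReal.mul_inv_cancel (by simp) (by simp), one_pow, one_mul]
    _ ≤ _ := by gcongr

theorem half_le_universalTest (z : Cantor × ProbabilityMeasure Cantor) :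
    2⁻¹ ≤ universalTest z := by
  have h : UniversalEnum ((1, 1), [], []) := Or.inl rfl
  have := le_supOf (basis := basicPairs) (x := z) h
    ⟨mem_cylinder_nil _, by simp [basicMeasures]⟩
  have h1 : (((nonnegRatVal (1, 1) : ℚ≥0) : ℝ≥0) : ℝ≥0∞) = 2⁻¹ := by
    simpa using nonnegRatVal_two_pow 1 1
  rwa [h1] at this

theorem isUniversalUniformTest_universalTest : IsUniversalUniformTest universalTest := by
  refine ⟨isUniformTest_universalTest, fun t ht => ?_⟩
  obtain ⟨e, he⟩ := ht.1.exists_le_universalTest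
  -- The additive `1` is absorbed by twice the floor `1/2`.
  refine ⟨2 + 2 ^ e, fun z => (he z.2 z.1 (ht.2 z.2)).trans ?_⟩
  push_cast
  rw [add_mul]
  gcongr
  calc (1 : ℝ≥0∞) = 2 * 2⁻¹ := (ENNReal.mul_inv_cancel (by simp) (by simp)).symm
    _ ≤ _ := by gcongr; exact half_le_universalTest z

theorem uniformlyRandom_iff {P : ProbabilityMeasure Cantor} {ω : Cantor} :
    UniformlyRandom P ω ↔ universalTest (ω, P) < ∞ := by
  refine ⟨fun ⟨u, hu, hfin⟩ => ?_, fun h => ⟨_, isUniversalUniformTest_universalTest, h⟩⟩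
  obtain ⟨c, hc⟩ := hu.2 _ isUniformTest_universalTest
  exact (hc _).trans_lt (ENNReal.mul_lt_top ENNReal.coe_lt_top hfin)

theorem UniformlyRandom.blindlyRandom {P : ProbabilityMeasure Cantor} {ω : Cantor}
    (h : UniformlyRandom P ω) : BlindlyRandom P ω := by
  rintro t ⟨⟨W, hW, htW⟩, ht⟩
  have hlsc : LowerSemicomputable basicPairs
      fun z : Cantor × ProbabilityMeasure Cantor => t z.1 := by
    refine ⟨fun a => W (a.1, a.2.1), hW.comp (Primrec.fst.pair (Primrec.fst.comp Primrec.snd)),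
      fun q z => (htW q z.1).trans ⟨?_, ?_⟩⟩
    · rintro ⟨x, hx, hz⟩
      exact ⟨(x, []), hx, hz, by simp [basicMeasures]⟩
    · rintro ⟨b, hb, hz⟩
      exact ⟨b.1, hb, hz.1⟩
  obtain ⟨e, he⟩ := hlsc.exists_le_universalTest
  refine (he P ω ht).trans_lt ?_
  refine ENNReal.add_lt_top.2 ⟨ENNReal.one_lt_top, ENNReal.mul_lt_top ?_ (uniformlyRandom_iff.1 h)⟩
  exact ENNReal.pow_lt_top ENNReal.ofNat_lt_top

/-- A uniform test, minimized over the measures of an effectively compact class outside the basic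
sets listed in `E`, is a blind test for each of these measures. -/
theorem exists_blindTest {C : Set (ProbabilityMeasure Cantor)} (hC : EffectivelyCompact C)
    (E : List (List Condition)) {t : Cantor × ProbabilityMeasure Cantor → ℝ≥0∞}
    (ht : IsUniformTest t) :
    ∃ s : Cantor → ℝ≥0∞,
      (∀ P ∈ C, (∀ β ∈ E, P ∉ basicMeasures β) → IsBlindTest P s) ∧
      ∀ ω, (∀ P ∈ C, (∀ β ∈ E, P ∉ basicMeasures β) → t (ω, P) = ∞) → s ω = ∞ := by
  obtain ⟨⟨W, hW, htW⟩, ht_le⟩ := ht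
  -- The boxes in `L` witness that `t` exceeds the rational over the whole cylinder of `a.2`, at
  -- every measure of `C` outside the sets of `E`. Effective compactness makes the covering clause
  -- enumerable.
  let V : (ℕ × ℕ) × List Bool → Prop := fun a => ∃ L : List (List Bool × List Condition),
    (∀ b ∈ L, W (a.1, b) ∧ b.1 <+: a.2) ∧ C ⊆ ⋃ β ∈ L.map Prod.snd ++ E, basicMeasures β
  have hV : REPred V := by
    refine REPred.exists (p := fun x : ((ℕ × ℕ) × List Bool) × List (List Bool × List Condition) =>
      (∀ b ∈ x.2, W (x.1.1, b) ∧ b.1 <+: x.1.2) ∧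
        C ⊆ ⋃ β ∈ x.2.map Prod.snd ++ E, basicMeasures β) (REPred.and ?_ ?_)
    · refine REPred.forall_mem
        (p := fun y : (((ℕ × ℕ) × List Bool) × List (List Bool × List Condition)) ×
          (List Bool × List Condition) => W (y.1.1.1, y.2) ∧ y.2.1 <+: y.1.1.2)
        (REPred.and (hW.comp ?_) (PrimrecPred.rePred ?_)) Primrec.snd
      · exact (Primrec.fst.comp (Primrec.fst.comp Primrec.fst)).pair Primrec.snd
      · exact Primrec.list_isPrefix.comp ((Primrec.fst.comp Primrec.snd).pair
          (Primrec.snd.comp (Primrec.fst.comp Primrec.fst)))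
    · exact hC.2.comp (Primrec.list_append.comp
        (Primrec.list_map Primrec.snd ((Primrec.snd.comp Primrec.snd).to₂)) (Primrec.const E))
  refine ⟨supOf cylinder V, fun P hP hPE => ⟨lowerSemicomputable_supOf hV, ?_⟩, fun ω hω => ?_⟩
  · refine (lintegral_mono fun ω => ?_).trans (ht_le P)
    refine supOf_le fun q x hq hx => ?_
    obtain ⟨L, hL, hcover⟩ := hq
    have hPL := hcover hP
    simp only [Set.mem_iUnion, exists_prop] at hPL
    obtain ⟨β, hβ, hPβ⟩ := hPL
    rcases List.mem_append.1 hβ with h | h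
    · obtain ⟨b, hb, rfl⟩ := List.mem_map.1 h
      exact ((htW q (ω, P)).2
        ⟨b, (hL b hb).1, mem_cylinder_of_prefix (hL b hb).2 hx, hPβ⟩).le
    · exact absurd hPβ (hPE β h)
  · refine ENNReal.eq_top_of_forall_nnreal_le fun r => ?_
    obtain ⟨k, hk⟩ := exists_nat_ge r
    have hk' : (r : ℝ≥0∞) ≤ k := by exact_mod_cast hk
    refine hk'.trans ?_
    let B : Set (List Bool × List Condition) := {b | W ((k, 0), b) ∧ ω ∈ cylinder b.1}
    have hcov : C ⊆ ⋃ β ∈ Prod.snd '' B ∪ {β | β ∈ E}, basicMeasures β := by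
      intro P hP
      simp only [Set.mem_iUnion, exists_prop]
      by_cases hPE : ∀ β ∈ E, P ∉ basicMeasures β
      · have : (((nonnegRatVal (k, 0) : ℚ≥0) : ℝ≥0) : ℝ≥0∞) < t (ω, P) := by
          rw [hω P hP hPE]; exact ENNReal.coe_lt_top
        obtain ⟨b, hb, h1, h2⟩ := (htW _ _).1 this
        exact ⟨b.2, Or.inl ⟨b, ⟨hb, h1⟩, rfl⟩, h2⟩
      · push Not at hPE
        obtain ⟨β, hβ, hPβ⟩ := hPE
        exact ⟨β, Or.inr hβ, hPβ⟩
    obtain ⟨F, hF, hFfin, hFcov⟩ :=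
      hC.1.elim_finite_subcover_image (fun β _ => isOpen_basicMeasures β) hcov
    have hF' : ∀ β ∈ F, β ∈ E ∨ ∃ b ∈ B, b.2 = β := fun β hβ => (hF hβ).symm
    classical
    have hL : ∃ L : List (List Bool × List Condition), (∀ b ∈ L, b ∈ B) ∧
        ∀ β ∈ F, β ∈ L.map Prod.snd ++ E := by
      choose! g hg using fun β (hβ : β ∈ F ∧ β ∉ E) => (hF' β hβ.1).resolve_left hβ.2
      refine ⟨(hFfin.toFinset.filter fun β => β ∉ E).toList.map g, fun b hb => ?_, fun β hβ => ?_⟩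
      · obtain ⟨β, hβ, rfl⟩ := List.mem_map.1 hb
        exact (hg β (by simpa using hβ)).1
      · by_cases h : β ∈ E
        · exact List.mem_append_right _ h
        · refine List.mem_append_left _ (List.mem_map.2 ⟨g β, List.mem_map_of_mem ?_,
            (hg β ⟨hβ, h⟩).2⟩)
          simpa using ⟨hβ, h⟩
    obtain ⟨L, hLB, hLF⟩ := hL
    -- The sum of the lengths makes the initial segment extend every word of the finite cover.
    have hVk : V ((k, 0), initSeg ω (L.map fun b => b.1.length).sum) := by
      refine ⟨L, fun b hb => ⟨(hLB b hb).1, ?_⟩, fun P hP => ?_⟩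
      · refine prefix_of_mem_cylinder (hLB b hb).2 (mem_cylinder_initSeg _ _) ?_
        rw [length_initSeg]
        exact List.le_sum_of_mem (List.mem_map_of_mem (f := fun b => b.1.length) hb)
      · obtain ⟨β, hβ, hPβ⟩ := Set.mem_iUnion₂.1 (hFcov hP)
        exact Set.mem_iUnion₂.2 ⟨β, hLF β hβ, hPβ⟩
    have := le_supOf (basis := cylinder) hVk (mem_cylinder_initSeg ω _)
    rwa [nonnegRatVal_natCast] at this

end AlgRandom

theorem mainTheorem7 (C : Set (MeasureTheory.ProbabilityMeasure AlgRandom.Cantor))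
    (hcompact : AlgRandom.EffectivelyCompact C)
    (horth : AlgRandom.EffectivelyOrthogonal C)
    (P : MeasureTheory.ProbabilityMeasure AlgRandom.Cantor) (hP : P ∈ C)
    (ω : AlgRandom.Cantor) :
    AlgRandom.UniformlyRandom P ω ↔ AlgRandom.BlindlyRandom P ω := by
  refine ⟨AlgRandom.UniformlyRandom.blindlyRandom, fun hblind => ?_⟩
  by_contra hP'
  -- `E` holds a neighbourhood of the only measure of `C` for which `ω` is uniformly random, or is
  -- empty if there is none.
  have key : ∃ E : List (List AlgRandom.Condition),
      (∀ β ∈ E, P ∉ AlgRandom.basicMeasures β) ∧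
      ∀ Q ∈ C, (∀ β ∈ E, Q ∉ AlgRandom.basicMeasures β) → ¬ AlgRandom.UniformlyRandom Q ω := by
    by_cases h : ∃ Q ∈ C, AlgRandom.UniformlyRandom Q ω
    · obtain ⟨Q, hQ, hQω⟩ := h
      have hPQ : P ≠ Q := fun h => hP' (h ▸ hQω)
      obtain ⟨β, hPβ, hQβ⟩ := AlgRandom.exists_basicMeasures_separating hPQ
      refine ⟨[β], by simpa using hPβ, fun R hR hRβ hRω => ?_⟩
      have hRQ : R ≠ Q := fun h => hRβ β List.mem_cons_self (h ▸ hQβ)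
      have : ω ∈ AlgRandom.Randoms R ∩ AlgRandom.Randoms Q := ⟨hRω, hQω⟩
      rw [horth R hR Q hQ hRQ] at this
      exact this
    · push Not at h
      exact ⟨[], by simp, fun Q hQ _ => h Q hQ⟩
  obtain ⟨E, hPE, hE⟩ := key
  obtain ⟨s, hs, hs_top⟩ := AlgRandom.exists_blindTest hcompact E
    AlgRandom.isUniformTest_universalTest
  refine (hblind s (hs P hP hPE)).ne (hs_top ω fun Q hQ hQE => ?_)
  have := hE Q hQ hQE
  rwa [AlgRandom.uniformlyRandom_iff, not_lt, top_le_iff] at this
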